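/- Let $\mathcal A$ be a finite alphabet, let $Q\ge 2$, and let $\varrho$ be a primitive bijective substitution of constant length $Q$ on $\mathcal A$, that is, each letter $a$ is mapped to a word $\varrho(a)=\varrho(a)_0\cdots\varrho(a)_{Q-1}$ of length $Q$; for every $0\le j<Q$ the map $a\mapsto\varrho(a)_j$ is a permutation of $\mathcal A$; and for some $N\ge 1$ each word $\varrho^N(a)$ contains all letters. A word is called legal if it is a factor of $\varrho^m(a)$ for some $m\ge 0$ and $a\in\mathcal A$. Let $k$ be a positive integer such that $a^{k+1}$ is not legal for any $a\in\mathcal A$. The substitution acts on $\mathcal A^{\mathbb Z}$ by $\varrho(v)_{Qi+j}=\varrho(v_i)_j$ for $i\in\mathbb Z$, $0\le j<Q$. Let $v\in\mathcal A^{\mathbb Z}$ be a repetitive fixed point of $\varrho$ or, more generally, of a power of $\varrho$: $\varrho^p(v)=v$ for some $p\ge1$, and each finite factor of $v$ reoccurs in $v$ with bounded gaps. Let $X_v$ be the closure of the shift orbit of $v$ in the product topology, and let $\mu$ be the shift-invariant Borel probability measure on $X_v$. (It is unique; the statements are asserted for every shift-invariant Borel probability measure $\mu$ on $X_v$.) For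 $n\ge 1$ and $a\in\mathcal A$, put $$C_{n,a}=\{u\in X_v : u_0=u_n=u_{2n}=\cdots=u_{kn}=a\}.$$ We say that $v$ contains an arithmetic progression of the letter $a$ with difference $d$ and length $L$ if there is $t\in\mathbb Z$ with $v_t=v_{t+d}=\cdots=v_{t+(L-1)d}=a$. Then the following hold. (1) There are $n>0$ and $a\in\mathcal A$ with $\mu(C_{n,a})>0$. If $\mu(C_{n,a})>0$ and $n=Q^s n'$ with integers $s\ge0$ and $n'>0$, then $\mu(C_{n',b})>0$ for some $b\in\mathcal A$. If $n>0$, $\mu(C_{n,a})>0$, and $m\ge0$ is such that for every $c\in\mathcal A$ the word $\varrho^m(c)$ contains all letters of $\mathcal A$, then $\mu(C_{Q^m n,b})>0$ for every $b\in\mathcal A$. (2) Suppose that $a\in\mathcal A$, $n>0$, $\mu(C_{n,a})>0$, and that $n$ and $Q$ are coprime. Then there is $m_0>0$ such that, for all $m>m_0$, $v$ contains no arithmetic progression of the letter $a$ with difference $Q^m+n$ and length $Q^m+k$, and none with difference $Q^m-n$ and length $Q^m+k$. (3) Suppose that $\mathcal A$ has exactly two letters. Then there are positive integers $n$ and $m_0$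 such that, for all $s\ge0$ and $m\ge m_0$ and every letter $a\in\mathcal A$, $v$ contains no arithmetic progression of the letter $a$ with difference $Q^{m+s}+Q^s n$ and length $Q^m+k$, and none with difference $Q^{m+s}-Q^s n$ and length $Q^m+k$. -/

import Mathlib

namespace BijSubst

/-- The action on finite words, by concatenation, of the substitution of constant length `Q`
that maps a letter `a` to the word `ϱ a 0, …, ϱ a (Q - 1)`. -/
def onWord {A : Type*} {Q : ℕ} (ϱ : A → Fin Q → A) (w : List A) : List A :=
  w.flatMap fun a => List.ofFn (ϱ a)

/-- The superword `ϱ ^ m (a)`. -/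
def superword {A : Type*} {Q : ℕ} (ϱ : A → Fin Q → A) (m : ℕ) (a : A) : List A :=
  (onWord ϱ)^[m] [a]

/-- Every image of `ϱ ^ m` contains all letters. -/
def ContainsAllLetters {A : Type*} {Q : ℕ} (ϱ : A → Fin Q → A) (m : ℕ) : Prop :=
  ∀ c b : A, b ∈ superword ϱ m c

/-- Primitivity: some positive power of `ϱ` maps every letter to a word with all letters. -/
def Primitive {A : Type*} {Q : ℕ} (ϱ : A → Fin Q → A) : Prop :=
  ∃ N : ℕ, 0 < N ∧ ContainsAllLetters ϱ N

/-- Bijectivity: in each column `j`, the map `a ↦ ϱ(a)_j` is a permutation of the alphabet. -/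
def Bijective {A : Type*} {Q : ℕ} (ϱ : A → Fin Q → A) : Prop :=
  ∀ j : Fin Q, Function.Bijective fun a => ϱ a j

/-- A word is legal (in the language of `ϱ`) if it is a factor of some superword. -/
def Legal {A : Type*} {Q : ℕ} (ϱ : A → Fin Q → A) (w : List A) : Prop :=
  ∃ (m : ℕ) (a : A), w <:+: superword ϱ m a

/-- The action on bi-infinite words: `ϱ(v)_{Q i + j} = ϱ(v_i)_j` for `0 ≤ j < Q`. -/
def onBiinf {A : Type*} {Q : ℕ} [NeZero Q] (ϱ : A → Fin Q → A) (v : ℤ → A) : ℤ → A :=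
  fun i => ϱ (v (i / (Q : ℤ))) ⟨(i % (Q : ℤ)).toNat, by
    have hQ : 0 < (Q : ℤ) := by exact_mod_cast NeZero.pos Q
    have h0 := Int.emod_nonneg i hQ.ne'
    have h1 := Int.emod_lt_of_pos i hQ
    omega⟩

/-- Repetitivity: every factor of `v` reoccurs in `v` with bounded gaps. -/
def Repetitive {A : Type*} (v : ℤ → A) : Prop :=
  ∀ (i : ℤ) (L : ℕ), ∃ R : ℕ, ∀ j : ℤ, ∃ t : ℤ, j ≤ t ∧ t ≤ j + R ∧
    ∀ l : ℕ, l < L → v (t + l) = v (i + l)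

/-- The shift map. -/
def shift {A : Type*} (u : ℤ → A) : ℤ → A := fun i => u (i + 1)

/-- The shift space `X_v`: the closure of the orbit of `v` under the `ℤ`-action by shifts, in the
product topology. -/
def hull {A : Type*} [TopologicalSpace A] (v : ℤ → A) : Set (ℤ → A) :=
  closure (Set.range fun (t : ℤ) (i : ℤ) => v (i + t))

/-- `μ` is a shift-invariant probability measure on `X_v` (viewed as a measure on the full shift
that is concentrated on `X_v`). -/
structure IsInvariantProbability {A : Type*} [TopologicalSpace A] [MeasurableSpace A]
    (v : ℤ → A) (μ : MeasureTheory.Measure (ℤ → A)) : Prop where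
  prob : MeasureTheory.IsProbabilityMeasure μ
  invariant : MeasureTheory.MeasurePreserving shift μ μ
  concentrated : μ (hull v) = 1

/-- The set `C_{n,a} = {u ∈ X_v : u_0 = u_n = u_{2n} = ⋯ = u_{kn} = a}`. -/
def progSet {A : Type*} [TopologicalSpace A] (v : ℤ → A) (k n : ℕ) (a : A) : Set (ℤ → A) :=
  {u | u ∈ hull v ∧ ∀ i : ℕ, i ≤ k → u ((i * n : ℕ) : ℤ) = a}

/-- `v` contains an arithmetic progression of the letter `a` with difference `d` and length `L`. -/
def HasProgression {A : Type*} (v : ℤ → A) (a : A) (d : ℤ) (L : ℕ) : Prop :=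
  ∃ t : ℤ, ∀ i : ℕ, i < L → v (t + i * d) = a

end BijSubst

/-!
The letters of `ϱ ^ m (c)` are the values at `c` of the columns `col ϱ m r`, `r < Q ^ m`, and each
column is a permutation of the alphabet.

By repetitivity, `C_{n,a}` has positive measure exactly if `v` contains a progression of `k + 1`
letters `a` with difference `n` (`measure_progSet_pos_iff`); this turns everything into
combinatorics of `v`. Positivity for some `n` and `a` is van der Waerden's theorem. The words
`ϱ ^ j (v)` all have the same factors as `v`, so the differences can be divided or multiplied by
powers of `Q`, by passing to preimages or images under `ϱ ^ s` (`HasProgression.desubstitute`,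
`HasProgression.substitute`, `HasProgression.of_iterate`).

Suppose that `n` is coprime to `Q` and that `v` contains the progression above. For large `m` it
lies inside some `ϱ ^ m (c)`, say at the positions `r, r + n, …, r + kn`. Steps of length
`Q ^ m + n` move to the next block of length `Q ^ m` and by `n` inside it. Among the first `Q ^ m`
terms of a progression with that difference, one is at position `r` of its block, as `n` is
invertible modulo `Q ^ m`, and the `k` terms that follow are at `r + n, …, r + kn` in the next
blocks. If all of these are `a`, then injectivity of the columns makes the `k + 1` blocks images of
`c`, so `c ^ (k + 1)` is legal, which is excluded (`HasProgression.exists_run`). The difference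
`Q ^ m - n` meets the same columns in the opposite order.

For two letters, a suitable `n` coprime to `Q` is `Q ^ (k + 1) + 1`, as columns are involutions
(`hasProgression_pow_add_one_of_card_eq_two`). Moreover, two columns that agree at one letter are
equal, so a single `n` serves both letters.
-/

namespace BijSubst

variable {A : Type*} {Q : ℕ} [NeZero Q] {ϱ : A → Fin Q → A}

/-! ### Columns of the powers of the substitution -/

/-- The `r`-th column of `ϱ ^ m`, which maps a letter `c` to the letter `ϱ ^ m (c)_r`. It is defined
for all `r`, but it has this meaning only for `r < Q ^ m`. -/
def col (ϱ : A → Fin Q → A) : ℕ → ℕ → A → A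
  | 0, _, c => c
  | m + 1, r, c => ϱ (col ϱ m (r / Q) c) (Fin.ofNat Q r)

theorem flatMap_range_ofFn (f : ℕ → Fin Q → A) (n : ℕ) :
    ((List.range n).flatMap fun i => List.ofFn (f i)) =
      (List.range (n * Q)).map fun i => f (i / Q) (Fin.ofNat Q i) := by
  have hQ : 0 < Q := NeZero.pos Q
  induction n with
  | zero => simp
  | succ n ih =>
    rw [List.range_succ, List.flatMap_append, ih, add_mul, one_mul, List.range_add,
      List.map_append]
    congr 1
    rw [List.flatMap_singleton, List.map_map]
    apply List.ext_getElem
    · simp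
    · intro i h₁ h₂
      have hi : i < Q := by simpa using h₁
      have hdiv : (n * Q + i) / Q = n := by
        rw [mul_comm, Nat.mul_add_div hQ, Nat.div_eq_of_lt hi, add_zero]
      have hmod : Fin.ofNat Q (n * Q + i) = ⟨i, hi⟩ := by
        apply Fin.ext
        simp [Fin.ofNat, Nat.mod_eq_of_lt hi]
      simp only [List.getElem_ofFn, List.getElem_map, List.getElem_range, Function.comp_apply, hdiv,
        hmod]

theorem superword_eq_map_col (m : ℕ) (c : A) :
    superword ϱ m c = (List.range (Q ^ m)).map fun r => col ϱ m r c := by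
  induction m with
  | zero => simp [superword, col]
  | succ m ih =>
    have h : superword ϱ (m + 1) c = onWord ϱ (superword ϱ m c) :=
      Function.iterate_succ_apply' _ _ _
    rw [h, ih, onWord, List.flatMap_map, flatMap_range_ofFn, pow_succ]
    rfl

theorem mem_superword {m : ℕ} {b c : A} :
    b ∈ superword ϱ m c ↔ ∃ r < Q ^ m, col ϱ m r c = b := by
  simp [superword_eq_map_col]

theorem legal_replicate {M r L : ℕ} {c x : A} (hr : r + L ≤ Q ^ M)
    (h : ∀ i < L, col ϱ M (r + i) x = c) : Legal ϱ (List.replicate L c) := by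
  refine ⟨M, x, ?_⟩
  have hw : List.replicate L c = ((superword ϱ M x).drop r).take L := by
    apply List.ext_getElem
    · simp [superword_eq_map_col]
      omega
    · intro i h₁ h₂
      simp [superword_eq_map_col, h i (by simpa using h₁)]
  rw [hw]
  exact (List.take_prefix _ _).isInfix.trans (List.drop_suffix _ _).isInfix

theorem col_bijective (hbij : Bijective ϱ) (m r : ℕ) : Function.Bijective (col ϱ m r) := by
  induction m generalizing r with
  | zero => exact Function.bijective_id
  | succ m ih => exact (hbij (Fin.ofNat Q r)).comp (ih (r / Q))

/-- The columns reflect `ϱ ^ (m + s) = ϱ ^ s ∘ ϱ ^ m`. -/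
theorem col_add (m s r f : ℕ) (hf : f < Q ^ s) (c : A) :
    col ϱ (m + s) (Q ^ s * r + f) c = col ϱ s f (col ϱ m r c) := by
  have hQ : 0 < Q := NeZero.pos Q
  induction s generalizing f with
  | zero =>
    obtain rfl : f = 0 := by simpa using hf
    simp [col]
  | succ s ih =>
    have hdiv : (Q ^ (s + 1) * r + f) / Q = Q ^ s * r + f / Q := by
      rw [pow_succ', mul_assoc, Nat.mul_add_div hQ]
    have hmod : Fin.ofNat Q (Q ^ (s + 1) * r + f) = Fin.ofNat Q f := by
      apply Fin.ext
      simp [Fin.ofNat, pow_succ', mul_assoc]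
    have hf' : f / Q < Q ^ s := by
      rw [Nat.div_lt_iff_lt_mul hQ, ← pow_succ]
      exact hf
    rw [← add_assoc, col, hdiv, hmod, ih _ hf', col]

theorem iterate_onBiinf_apply (w : ℤ → A) (m : ℕ) (q : ℤ) (r : ℕ) (hr : r < Q ^ m) :
    (onBiinf ϱ)^[m] w ((Q : ℤ) ^ m * q + r) = col ϱ m r (w q) := by
  have hQ : 0 < Q := NeZero.pos Q
  have hQz : (Q : ℤ) ≠ 0 := by exact_mod_cast hQ.ne'
  induction m generalizing r with
  | zero =>
    obtain rfl : r = 0 := by simpa using hr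
    simp [col]
  | succ m ih =>
    have hr' : r / Q < Q ^ m := by
      rw [Nat.div_lt_iff_lt_mul hQ, ← pow_succ]
      exact hr
    have hpos : (Q : ℤ) ^ (m + 1) * q + r = r + (Q : ℤ) * ((Q : ℤ) ^ m * q) := by ring
    have hdiv : ((Q : ℤ) ^ (m + 1) * q + r) / Q = (Q : ℤ) ^ m * q + (r / Q : ℕ) := by
      rw [hpos, Int.add_mul_ediv_left _ _ hQz]
      push_cast
      ring
    have hmod : ((Q : ℤ) ^ (m + 1) * q + r) % Q = (r % Q : ℕ) := by
      rw [hpos, Int.add_mul_emod_self_left]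
      push_cast
      rfl
    rw [Function.iterate_succ_apply', onBiinf, hdiv, ih _ hr', col]
    congr 1
    apply Fin.ext
    simp only [hmod, Int.toNat_natCast]
    rfl

/-! ### Factors of the fixed point and of its images -/

theorem eq_iterate_iterate {v : ℤ → A} {p : ℕ} (hp : 0 < p) (hfix : (onBiinf ϱ)^[p] v = v)
    (m j : ℕ) : ∃ i, j ≤ i ∧ v = (onBiinf ϱ)^[m] ((onBiinf ϱ)^[i] v) := by
  have hle : m + j ≤ p * (m + j) := Nat.le_mul_of_pos_left _ hp
  refine ⟨p * (m + j) - m, by omega, ?_⟩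
  rw [← Function.iterate_add_apply, Nat.add_sub_cancel' (by omega), Function.iterate_mul]
  exact (Function.iterate_fixed hfix _).symm

/-- Every factor of `ϱ ^ j (v)` is legal. By repetitivity, a factor of `v` that overlaps the seam
between the positions `-1` and `0` reoccurs to the right of it, where `v` consists of prefixes of
powers of `ϱ` applied to `v 0`. -/
theorem exists_eq_col (hQ : 2 ≤ Q) {v : ℤ → A} {p : ℕ} (hp : 0 < p)
    (hfix : (onBiinf ϱ)^[p] v = v) (hrep : Repetitive v) (j : ℕ) (x : ℤ) (L : ℕ) :
    ∃ (M r : ℕ) (c : A), r + L ≤ Q ^ M ∧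
      ∀ l < L, (onBiinf ϱ)^[j] v (x + l) = col ϱ M (r + l) c := by
  have hQj : 0 < Q ^ j := pow_pos (NeZero.pos Q) j
  have hQjz : (0 : ℤ) < (Q : ℤ) ^ j := by exact_mod_cast hQj
  -- `L + 1` consecutive letters of `v` suffice: their images cover the window of length `L`.
  obtain ⟨R, hR⟩ := hrep (x / (Q : ℤ) ^ j) (L + 1)
  obtain ⟨t', ht0, -, ht⟩ := hR 0
  lift t' to ℕ using ht0 with t
  obtain ⟨f, hf⟩ := Int.eq_ofNat_of_zero_le (Int.emod_nonneg x hQjz.ne')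
  have hflt : f < Q ^ j := by
    have := Int.emod_lt_of_pos x hQjz
    rw [hf] at this
    exact_mod_cast this
  have hx : x = (Q : ℤ) ^ j * (x / (Q : ℤ) ^ j) + f := by
    rw [← hf]
    exact (Int.mul_ediv_add_emod x _).symm
  set y := x / (Q : ℤ) ^ j
  have hM : t + L + 1 < Q ^ (p * (t + L + 1)) :=
    calc t + L + 1 < Q ^ (t + L + 1) := Nat.lt_pow_self (by omega)
      _ ≤ Q ^ (p * (t + L + 1)) :=
        Nat.pow_le_pow_right (by omega) (Nat.le_mul_of_pos_left _ hp)
  set M := p * (t + L + 1) with hMdef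
  have hv : ∀ i < Q ^ M, v i = col ϱ M i (v 0) := by
    intro i hi
    have h := iterate_onBiinf_apply (ϱ := ϱ) v M 0 i hi
    rw [hMdef, Function.iterate_mul, Function.iterate_fixed hfix] at h
    simpa using h
  refine ⟨M + j, Q ^ j * t + f, v 0, ?_, fun l hl => ?_⟩
  · calc Q ^ j * t + f + L ≤ Q ^ j * t + Q ^ j * 1 + Q ^ j * L := by
          have := Nat.le_mul_of_pos_left L hQj
          omega
      _ = Q ^ j * (t + L + 1) := by ring
      _ ≤ Q ^ j * Q ^ M := Nat.mul_le_mul_left _ hM.le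
      _ = Q ^ (M + j) := by ring
  · have he : (f + l) / Q ^ j ≤ L := by
      rw [Nat.div_le_iff_le_mul_add_pred hQj]
      have := Nat.le_mul_of_pos_left l hQj
      have h2 : Q ^ j * (l + 1) ≤ Q ^ j * L := Nat.mul_le_mul_left _ hl
      rw [mul_add, mul_one] at h2
      omega
    have hdm := Nat.div_add_mod (f + l) (Q ^ j)
    have hg : (f + l) % Q ^ j < Q ^ j := Nat.mod_lt _ hQj
    generalize (f + l) / Q ^ j = e at he hdm
    generalize (f + l) % Q ^ j = g at hg hdm
    have h₁ : x + l = (Q : ℤ) ^ j * (y + e) + g := by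
      have : ((Q : ℤ) ^ j * e + g) = f + l := by exact_mod_cast hdm
      linarith
    have h₂ : Q ^ j * t + f + l = Q ^ j * (t + e) + g := by
      rw [mul_add]
      omega
    have h₃ : v (y + e) = v ((t + e : ℕ) : ℤ) := by
      push_cast
      exact (ht e (by omega)).symm
    rw [h₁, iterate_onBiinf_apply _ _ _ _ hg, h₂, col_add _ _ _ _ hg, h₃,
      hv _ (by omega)]

theorem legal_replicate_of_iterate (hQ : 2 ≤ Q) {v : ℤ → A} {p : ℕ} (hp : 0 < p)
    (hfix : (onBiinf ϱ)^[p] v = v) (hrep : Repetitive v) {j L : ℕ} {q : ℤ} {c : A}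
    (h : ∀ i < L, (onBiinf ϱ)^[j] v (q + i) = c) : Legal ϱ (List.replicate L c) := by
  obtain ⟨M, r, x, hr, hx⟩ := exists_eq_col hQ hp hfix hrep j q L
  exact legal_replicate hr fun i hi => (hx i hi).symm.trans (h i hi)

/-- By primitivity, every superword occurs in `v`. -/
theorem exists_superword_occurrence (hprim : Primitive ϱ) {v : ℤ → A} {p : ℕ} (hp : 0 < p)
    (hfix : (onBiinf ϱ)^[p] v = v) (M : ℕ) (c : A) :
    ∃ q : ℤ, ∀ r < Q ^ M, v (q + r) = col ϱ M r c := by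
  obtain ⟨N, -, hN⟩ := hprim
  obtain ⟨i, hi, hv⟩ := eq_iterate_iterate hp hfix M N
  obtain ⟨i, rfl⟩ := Nat.exists_eq_add_of_le hi
  obtain ⟨r₀, hr₀, hc⟩ := mem_superword.1 (hN ((onBiinf ϱ)^[i] v 0) c)
  have hcv : (onBiinf ϱ)^[N + i] v r₀ = c := by
    rw [Function.iterate_add_apply, ← hc, ← iterate_onBiinf_apply _ _ _ _ hr₀]
    simp
  refine ⟨(Q : ℤ) ^ M * r₀, fun r hr => ?_⟩
  rw [hv, iterate_onBiinf_apply _ _ _ _ hr, hcv]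

/-! ### Transfer of arithmetic progressions -/

theorem HasProgression.exists_eq_col (hQ : 2 ≤ Q) {v : ℤ → A} {p : ℕ} (hp : 0 < p)
    (hfix : (onBiinf ϱ)^[p] v = v) (hrep : Repetitive v) {j n k : ℕ} {a : A}
    (h : HasProgression ((onBiinf ϱ)^[j] v) a n (k + 1)) :
    ∃ (M r : ℕ) (c : A), r + k * n < Q ^ M ∧ ∀ i ≤ k, col ϱ M (r + i * n) c = a := by
  obtain ⟨t, ht⟩ := h
  obtain ⟨M, r, c, hr, hc⟩ := BijSubst.exists_eq_col hQ hp hfix hrep j t (k * n + 1)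
  refine ⟨M, r, c, by omega, fun i hi => ?_⟩
  rw [← hc _ (Nat.lt_succ_of_le (Nat.mul_le_mul_right n hi)), ← ht i (by omega)]
  push_cast
  rfl

theorem HasProgression.of_iterate (hQ : 2 ≤ Q) (hprim : Primitive ϱ) {v : ℤ → A} {p : ℕ}
    (hp : 0 < p) (hfix : (onBiinf ϱ)^[p] v = v) (hrep : Repetitive v) {j n k : ℕ} {a : A}
    (h : HasProgression ((onBiinf ϱ)^[j] v) a n (k + 1)) : HasProgression v a n (k + 1) := by
  obtain ⟨M, r, c, hr, hc⟩ := h.exists_eq_col hQ hp hfix hrep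
  obtain ⟨q, hq⟩ := exists_superword_occurrence hprim hp hfix M c
  refine ⟨q + r, fun i hi => ?_⟩
  have hle : i * n ≤ k * n := Nat.mul_le_mul_right n (by omega)
  rw [← hc i (by omega), ← hq _ (by omega)]
  push_cast
  ring_nf

/-- A progression in `ϱ ^ s (w)` whose difference is divisible by `Q ^ s` meets the blocks of length
`Q ^ s` in a single column, so it comes from a progression in `w`. -/
theorem HasProgression.desubstitute (hbij : Bijective ϱ) {w : ℤ → A} {s L : ℕ} {d : ℤ} {a : A}
    (h : HasProgression ((onBiinf ϱ)^[s] w) a ((Q : ℤ) ^ s * d) L) :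
    ∃ b, HasProgression w b d L := by
  obtain ⟨t, ht⟩ := h
  have hQs : (0 : ℤ) < (Q : ℤ) ^ s := by exact_mod_cast pow_pos (NeZero.pos Q) s
  obtain ⟨r, hr⟩ := Int.eq_ofNat_of_zero_le (Int.emod_nonneg t hQs.ne')
  have hrlt : r < Q ^ s := by
    have := Int.emod_lt_of_pos t hQs
    rw [hr] at this
    exact_mod_cast this
  have hdm := Int.mul_ediv_add_emod t ((Q : ℤ) ^ s)
  obtain ⟨b, hb⟩ := (col_bijective hbij s r).2 a
  refine ⟨b, t / (Q : ℤ) ^ s, fun i hi => (col_bijective hbij s r).1 ?_⟩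
  rw [hb, ← iterate_onBiinf_apply _ _ _ _ hrlt, ← ht i hi]
  refine congrArg _ ?_
  rw [hr] at hdm
  linear_combination hdm

theorem HasProgression.substitute {w : ℤ → A} {m r L : ℕ} {d : ℤ} {a : A}
    (h : HasProgression w a d L) (hr : r < Q ^ m) :
    HasProgression ((onBiinf ϱ)^[m] w) (col ϱ m r a) ((Q : ℤ) ^ m * d) L := by
  obtain ⟨t, ht⟩ := h
  refine ⟨(Q : ℤ) ^ m * t + r, fun i hi => ?_⟩
  rw [← ht i hi, ← iterate_onBiinf_apply _ _ _ _ hr]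
  refine congrArg _ ?_
  ring

/-! ### Progressions whose difference is close to a power of `Q` -/

/-- If the columns `ρ, ρ + δ, …, ρ + kδ` of `ϱ ^ m` all take the value `a` at `c` only, then a
progression of `a` in `ϱ ^ m (w)` with difference `Q ^ m + δ` and length `Q ^ m + k` forces the run
`c ^ (k + 1)` in `w`: among its first `Q ^ m` positions one is congruent to `ρ` modulo `Q ^ m`, and
from there on the progression meets these columns in consecutive blocks. -/
theorem HasProgression.exists_run {w : ℤ → A} {m k : ℕ} {ρ δ : ℤ} {a c : A}
    (h : HasProgression ((onBiinf ϱ)^[m] w) a ((Q : ℤ) ^ m + δ) (Q ^ m + k))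
    (hδ : IsCoprime δ Q) (hρ : ∀ i ≤ k, 0 ≤ ρ + i * δ ∧ ρ + i * δ < (Q : ℤ) ^ m)
    (hcol : ∀ i ≤ k, ∀ x, col ϱ m (ρ + i * δ).toNat x = a → x = c) :
    ∃ q : ℤ, ∀ i < k + 1, w (q + i) = c := by
  obtain ⟨t, ht⟩ := h
  have hQm : (0 : ℤ) < (Q : ℤ) ^ m := by exact_mod_cast pow_pos (NeZero.pos Q) m
  obtain ⟨u, z, huz⟩ := hδ.pow_right (n := m)
  obtain ⟨i₀, hi₀⟩ := Int.eq_ofNat_of_zero_le (Int.emod_nonneg ((ρ - t) * u) hQm.ne')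
  have hlt : i₀ < Q ^ m := by
    have := Int.emod_lt_of_pos ((ρ - t) * u) hQm
    rw [hi₀] at this
    exact_mod_cast this
  have hdm := Int.mul_ediv_add_emod ((ρ - t) * u) ((Q : ℤ) ^ m)
  rw [hi₀] at hdm
  generalize (ρ - t) * u / (Q : ℤ) ^ m = e at hdm
  refine ⟨i₀ - e * δ - (ρ - t) * z, fun i hi => hcol i (by omega) _ ?_⟩
  obtain ⟨h0, h1⟩ := hρ i (by omega)
  obtain ⟨f, hf⟩ := Int.eq_ofNat_of_zero_le h0
  rw [hf] at h1 ⊢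
  rw [Int.toNat_natCast, ← iterate_onBiinf_apply _ _ _ _ (by exact_mod_cast h1),
    ← ht (i₀ + i) (by omega)]
  refine congrArg _ ?_
  push_cast
  linear_combination -hf - δ * hdm - (ρ - t) * huz

theorem not_hasProgression_pow_add_sub (hQ : 2 ≤ Q) {k : ℕ}
    (hlegal : ∀ a : A, ¬ Legal ϱ (List.replicate (k + 1) a)) {v : ℤ → A} {p : ℕ} (hp : 0 < p)
    (hfix : (onBiinf ϱ)^[p] v = v) (hrep : Repetitive v) {n m r j : ℕ} {a c : A}
    (hn : Nat.Coprime n Q) (hr : r + k * n < Q ^ m)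
    (hcol : ∀ i ≤ k, ∀ x, col ϱ m (r + i * n) x = a → x = c) :
    ¬ HasProgression ((onBiinf ϱ)^[m] ((onBiinf ϱ)^[j] v)) a ((Q : ℤ) ^ m + n) (Q ^ m + k) ∧
    ¬ HasProgression ((onBiinf ϱ)^[m] ((onBiinf ϱ)^[j] v)) a ((Q : ℤ) ^ m - n) (Q ^ m + k) := by
  have hn' : IsCoprime (n : ℤ) Q := Nat.isCoprime_iff_coprime.2 hn
  have hle : ∀ i ≤ k, i * n ≤ k * n := fun i hi => Nat.mul_le_mul_right n hi
  have hlt : ∀ i ≤ k, ((r + i * n : ℕ) : ℤ) < (Q : ℤ) ^ m := fun i hi => by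
    have : r + i * n < Q ^ m := by have := hle i hi; omega
    exact_mod_cast this
  constructor
  · intro h
    have key : ∀ i : ℕ, (r : ℤ) + i * (n : ℤ) = ((r + i * n : ℕ) : ℤ) := fun i => by
      push_cast
      rfl
    obtain ⟨q, hq⟩ := h.exists_run (ρ := r) hn' (c := c)
      (fun i hi => by
        rw [key]
        exact ⟨by positivity, hlt i hi⟩)
      (fun i hi => by
        rw [key, Int.toNat_natCast]
        exact hcol i hi)
    exact hlegal c (legal_replicate_of_iterate hQ hp hfix hrep hq)
  · intro h
    -- With a negative offset the columns are met in descending order, from `r + kn` down to `r`.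
    have key : ∀ i ≤ k, ((r + k * n : ℕ) : ℤ) + i * (-n : ℤ) = ((r + (k - i) * n : ℕ) : ℤ) :=
      fun i hi => by
        push_cast [hi]
        ring
    rw [sub_eq_add_neg] at h
    obtain ⟨q, hq⟩ := h.exists_run (ρ := ((r + k * n : ℕ) : ℤ)) hn'.neg_left (c := c)
      (fun i hi => by
        rw [key i hi]
        exact ⟨by positivity, hlt _ (by omega)⟩)
      (fun i hi => by
        rw [key i hi, Int.toNat_natCast]
        exact hcol _ (by omega))
    exact hlegal c (legal_replicate_of_iterate hQ hp hfix hrep hq)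

/-- A progression in `v` occurs inside one superword of level `m`, for every large `m`. -/
theorem HasProgression.exists_eq_col_of_le (hQ : 2 ≤ Q) (hbij : Bijective ϱ) {v : ℤ → A} {p : ℕ}
    (hp : 0 < p) (hfix : (onBiinf ϱ)^[p] v = v) (hrep : Repetitive v) {n k : ℕ} {a : A}
    (h : HasProgression v a n (k + 1)) :
    ∃ M, ∀ m, M ≤ m → ∃ (r : ℕ) (c : A), r + k * n < Q ^ m ∧
      ∀ i ≤ k, col ϱ m (r + i * n) c = a := by
  obtain ⟨M, r, c, hr, hc⟩ := HasProgression.exists_eq_col (j := 0) hQ hp hfix hrep h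
  refine ⟨M, fun m hm => ?_⟩
  obtain ⟨e, rfl⟩ := Nat.exists_eq_add_of_le' hm
  obtain ⟨d, hd⟩ := (col_bijective hbij e 0).2 c
  refine ⟨r, d, hr.trans_le (Nat.pow_le_pow_right (by omega) (by omega)), fun i hi => ?_⟩
  have hle : i * n ≤ k * n := Nat.mul_le_mul_right n hi
  have := col_add (ϱ := ϱ) e M 0 (r + i * n) (by omega) d
  rw [mul_zero, zero_add] at this
  rw [this, hd, hc i hi]

/-! ### Two letters -/

theorem eq_of_ne_of_ne_of_card_eq_two (h2 : Nat.card A = 2) {x y z : A} (hx : x ≠ z)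
    (hy : y ≠ z) : x = y := by
  obtain ⟨a, b, -, hab⟩ := Nat.card_eq_two_iff.1 h2
  have h : ∀ c : A, c = a ∨ c = b := fun c => by
    have : c ∈ ({a, b} : Set A) := hab ▸ Set.mem_univ c
    simpa using this
  rcases h x with rfl | rfl <;> rcases h y with rfl | rfl <;> rcases h z with rfl | rfl <;> simp_all

/-- With two letters, every column is an involution. So reading a prefix of a superword both inside
the blocks of length `Q ^ M` and as the sequence of consecutive blocks yields the same letter along
the diagonal, which is a progression with difference `Q ^ M + 1`. -/
theorem hasProgression_pow_add_one_of_card_eq_two (hQ : 2 ≤ Q) (hprim : Primitive ϱ)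
    (hbij : Bijective ϱ) (h2 : Nat.card A = 2) {v : ℤ → A} {p : ℕ} (hp : 0 < p)
    (hfix : (onBiinf ϱ)^[p] v = v) (hrep : Repetitive v) {k M : ℕ} (hk : k < Q ^ M) (c : A) :
    HasProgression v c ((Q ^ M + 1 : ℕ) : ℤ) (k + 1) := by
  obtain ⟨q, hq⟩ := exists_superword_occurrence hprim hp hfix M c
  apply HasProgression.of_iterate (j := M) hQ hprim hp hfix hrep
  refine ⟨(Q : ℤ) ^ M * q, fun i hi => ?_⟩
  have hi' : i < Q ^ M := by omega
  have hpos : (Q : ℤ) ^ M * q + i * ((Q ^ M + 1 : ℕ) : ℤ) = (Q : ℤ) ^ M * (q + i) + i := by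
    push_cast
    ring
  have hinj := (col_bijective hbij M i).1
  rw [hpos, iterate_onBiinf_apply _ _ _ _ hi', hq i hi']
  by_cases hc : col ϱ M i c = c
  · rw [hc, hc]
  · exact eq_of_ne_of_ne_of_card_eq_two h2 (fun h => hc (hinj h)) (Ne.symm hc)

theorem not_hasProgression_of_card_eq_two (hQ : 2 ≤ Q) (hprim : Primitive ϱ) (hbij : Bijective ϱ)
    {k : ℕ} (hlegal : ∀ a : A, ¬ Legal ϱ (List.replicate (k + 1) a)) {v : ℤ → A} {p : ℕ}
    (hp : 0 < p) (hfix : (onBiinf ϱ)^[p] v = v) (hrep : Repetitive v) (h2 : Nat.card A = 2) :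
    ∃ n m₀ : ℕ, 0 < n ∧ 0 < m₀ ∧ ∀ s m : ℕ, m₀ ≤ m → ∀ a : A,
      ¬ HasProgression v a ((Q : ℤ) ^ (m + s) + (Q : ℤ) ^ s * n) (Q ^ m + k) ∧
      ¬ HasProgression v a ((Q : ℤ) ^ (m + s) - (Q : ℤ) ^ s * n) (Q ^ m + k) := by
  have hkQ : k < Q ^ (k + 1) := (Nat.lt_succ_self k).trans (Nat.lt_pow_self (by omega))
  have hn : Nat.Coprime (Q ^ (k + 1) + 1) Q := by
    rw [pow_succ, Nat.coprime_mul_right_add_left]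
    exact Nat.coprime_one_left Q
  obtain ⟨M, hM⟩ := (hasProgression_pow_add_one_of_card_eq_two hQ hprim hbij h2 hp hfix hrep hkQ
    (v 0)).exists_eq_col_of_le hQ hbij hp hfix hrep
  refine ⟨Q ^ (k + 1) + 1, M + 1, by omega, by omega, fun s m hm a => ?_⟩
  obtain ⟨r, c, hr, hc⟩ := hM m (by omega)
  -- The relevant columns agree at `c`; being permutations of two letters, they agree everywhere.
  have huniq : ∀ b, ∃ d, ∀ i ≤ k, ∀ x, col ϱ m (r + i * (Q ^ (k + 1) + 1)) x = b → x = d := by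
    intro b
    by_cases hb : b = v 0
    · exact ⟨c, fun i hi x hx =>
        (col_bijective hbij _ _).1 (hx.trans (hb.trans (hc i hi).symm))⟩
    · obtain ⟨d, hd⟩ := (col_bijective hbij m r).2 b
      have hdc : d ≠ c := by
        rintro rfl
        have := hc 0 (Nat.zero_le k)
        rw [zero_mul, add_zero] at this
        exact hb (hd.symm.trans this)
      refine ⟨d, fun i hi x hx => eq_of_ne_of_ne_of_card_eq_two h2 ?_ hdc⟩
      rintro rfl
      exact hb (hx.symm.trans (hc i hi))
  obtain ⟨i, -, hv⟩ := eq_iterate_iterate hp hfix (s + m) 0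
  rw [Function.iterate_add_apply] at hv
  constructor
  · intro h
    have hd : (Q : ℤ) ^ (m + s) + (Q : ℤ) ^ s * ((Q ^ (k + 1) + 1 : ℕ) : ℤ) =
        (Q : ℤ) ^ s * ((Q : ℤ) ^ m + ((Q ^ (k + 1) + 1 : ℕ) : ℤ)) := by ring
    rw [hv, hd] at h
    obtain ⟨b, hb⟩ := h.desubstitute hbij
    obtain ⟨d, hd⟩ := huniq b
    exact (not_hasProgression_pow_add_sub hQ hlegal hp hfix hrep hn hr hd).1 hb
  · intro h
    have hd : (Q : ℤ) ^ (m + s) - (Q : ℤ) ^ s * ((Q ^ (k + 1) + 1 : ℕ) : ℤ) =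
        (Q : ℤ) ^ s * ((Q : ℤ) ^ m - ((Q ^ (k + 1) + 1 : ℕ) : ℤ)) := by ring
    rw [hv, hd] at h
    obtain ⟨b, hb⟩ := h.desubstitute hbij
    obtain ⟨d, hd⟩ := huniq b
    exact (not_hasProgression_pow_add_sub hQ hlegal hp hfix hrep hn hr hd).2 hb

/-! ### Progressions and the invariant measure -/

theorem exists_hasProgression [Finite A] (v : ℤ → A) (L : ℕ) :
    ∃ (n : ℕ) (a : A), 0 < n ∧ HasProgression v a n L := by
  obtain ⟨n, hn, b, a, h⟩ := Combinatorics.exists_mono_homothetic_copy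
    ((Finset.range L).image fun i : ℕ => (i : ℤ)) v
  refine ⟨n, a, hn, b, fun i hi => ?_⟩
  rw [← h i (Finset.mem_image_of_mem _ (Finset.mem_range.2 hi))]
  congr 1
  simp
  ring

theorem iterate_shift_apply (u : ℤ → A) (t : ℕ) (i : ℤ) : shift^[t] u i = u (i + t) := by
  induction t generalizing i with
  | zero => simp
  | succ t ih =>
    rw [Function.iterate_succ_apply', shift, ih]
    push_cast
    congr 1
    ring

section Measure

variable [TopologicalSpace A] [DiscreteTopology A]

theorem isClopen_setOf_apply_eq (i : ℤ) (a : A) : IsClopen {u : ℤ → A | u i = a} :=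
  (isClopen_discrete {a}).preimage (continuous_apply i)

theorem isClopen_setOf_forall_le_apply_eq (x : ℕ → ℤ) (k : ℕ) (a : A) :
    IsClopen {u : ℤ → A | ∀ i ≤ k, u (x i) = a} := by
  have h : {u : ℤ → A | ∀ i ≤ k, u (x i) = a} = ⋂ i ∈ Set.Iic k, {u : ℤ → A | u (x i) = a} := by
    ext u
    simp
  rw [h]
  exact (Set.finite_Iic k).isClopen_biInter fun i _ => isClopen_setOf_apply_eq _ _

theorem hasProgression_of_progSet_nonempty {v : ℤ → A} {k n : ℕ} {a : A}
    (h : (progSet v k n a).Nonempty) : HasProgression v a n (k + 1) := by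
  obtain ⟨u, hu, hua⟩ := h
  obtain ⟨_, hw, t, rfl⟩ := mem_closure_iff.1 hu _
    (isClopen_setOf_forall_le_apply_eq (fun i : ℕ => ((i * n : ℕ) : ℤ)) k a).isOpen hua
  refine ⟨t, fun i hi => ?_⟩
  rw [← hw i (by omega)]
  push_cast
  congr 1
  ring

/-- By repetitivity, a progression in `v` reoccurs in all elements of the hull with a uniform bound
on the gaps. -/
theorem exists_hull_subset {v : ℤ → A} (hrep : Repetitive v) {k n : ℕ} {a : A}
    (h : HasProgression v a n (k + 1)) :
    ∃ R : ℕ, hull v ⊆ ⋃ t ∈ Set.Iic R, {u : ℤ → A | ∀ i ≤ k, u (((i * n : ℕ) : ℤ) + t) = a} := by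
  obtain ⟨t, ht⟩ := h
  obtain ⟨R, hR⟩ := hrep t (k * n + 1)
  refine ⟨R, closure_minimal ?_ ((Set.finite_Iic R).isClosed_biUnion fun x _ =>
    (isClopen_setOf_forall_le_apply_eq (fun i : ℕ => ((i * n : ℕ) : ℤ) + x) k a).isClosed)⟩
  rintro _ ⟨j, rfl⟩
  obtain ⟨x, hx, hxR, hxv⟩ := hR j
  obtain ⟨e, he⟩ := Int.eq_ofNat_of_zero_le (sub_nonneg.2 hx)
  refine Set.mem_biUnion (x := e) (by simp only [Set.mem_Iic]; omega) fun i hi => ?_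
  have := hxv (i * n) (Nat.lt_succ_of_le (Nat.mul_le_mul_right n hi))
  have h₁ : ((i * n : ℕ) : ℤ) + e + j = x + ((i * n : ℕ) : ℤ) := by
    linear_combination -he
  simp only [h₁, this, ← ht i (by omega)]
  push_cast
  rfl

/-- The set `C_{n,a}` has positive measure exactly if `v` itself contains a progression of `k + 1`
letters `a` with difference `n`. -/
theorem measure_progSet_pos_iff [Finite A] [MeasurableSpace A] [MeasurableSingletonClass A]
    {v : ℤ → A} (hrep : Repetitive v) {μ : MeasureTheory.Measure (ℤ → A)}
    (hμ : IsInvariantProbability v μ) {k n : ℕ} {a : A} :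
    0 < μ (progSet v k n a) ↔ HasProgression v a n (k + 1) := by
  refine ⟨fun h => hasProgression_of_progSet_nonempty
    (MeasureTheory.nonempty_of_measure_ne_zero h.ne'), fun h => ?_⟩
  have := hμ.prob
  have hhull : MeasurableSet (hull v) := isClosed_closure.measurableSet
  have hae : hull v ∈ MeasureTheory.ae μ :=
    (MeasureTheory.prob_compl_eq_zero_iff hhull).2 hμ.concentrated
  set S : Set (ℤ → A) := {u | ∀ i ≤ k, u ((i * n : ℕ) : ℤ) = a} with hS
  have hSm : MeasurableSet S :=
    (isClopen_setOf_forall_le_apply_eq (fun i : ℕ => ((i * n : ℕ) : ℤ)) k a).isOpen.measurableSet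
  have hprog : μ (progSet v k n a) = μ S := by
    rw [show progSet v k n a = S ∩ hull v from Set.inter_comm _ _]
    exact MeasureTheory.measure_inter_conull hae
  rw [hprog, pos_iff_ne_zero]
  intro h0
  obtain ⟨R, hR⟩ := exists_hull_subset hrep h
  have hnull : μ (hull v) = 0 := by
    refine MeasureTheory.measure_mono_null hR
      ((MeasureTheory.measure_biUnion_null_iff (Set.to_countable _)).2 fun t _ => ?_)
    have hpre : {u : ℤ → A | ∀ i ≤ k, u (((i * n : ℕ) : ℤ) + t) = a} = shift^[t] ⁻¹' S := by
      ext u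
      simp [hS, iterate_shift_apply]
    rw [hpre, (hμ.invariant.iterate t).measure_preimage hSm.nullMeasurableSet, h0]
  exact one_ne_zero (hμ.concentrated.symm.trans hnull)

end Measure

end BijSubst

theorem mainTheorem6 {A : Type*} [Finite A] [TopologicalSpace A] [DiscreteTopology A]
    [MeasurableSpace A] [MeasurableSingletonClass A]
    (Q : ℕ) [NeZero Q] (hQ : 2 ≤ Q) (ϱ : A → Fin Q → A)
    (hprim : BijSubst.Primitive ϱ) (hbij : BijSubst.Bijective ϱ)
    (k : ℕ) (hk : 0 < k) (hlegal : ∀ a : A, ¬ BijSubst.Legal ϱ (List.replicate (k + 1) a))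
    (v : ℤ → A) (p : ℕ) (hp : 0 < p) (hfix : (BijSubst.onBiinf ϱ)^[p] v = v)
    (hrep : BijSubst.Repetitive v) :
    (∀ μ : MeasureTheory.Measure (ℤ → A), BijSubst.IsInvariantProbability v μ →
      (∃ (n : ℕ) (a : A), 0 < n ∧ 0 < μ (BijSubst.progSet v k n a)) ∧
      (∀ (n : ℕ) (a : A) (s n' : ℕ), 0 < μ (BijSubst.progSet v k n a) → 0 < n' →
        n = Q ^ s * n' → ∃ b : A, 0 < μ (BijSubst.progSet v k n' b)) ∧
      (∀ (n : ℕ) (a : A) (m : ℕ), 0 < n → 0 < μ (BijSubst.progSet v k n a) →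
        BijSubst.ContainsAllLetters ϱ m →
        ∀ b : A, 0 < μ (BijSubst.progSet v k (Q ^ m * n) b)) ∧
      (∀ (n : ℕ) (a : A), 0 < n → 0 < μ (BijSubst.progSet v k n a) → Nat.Coprime n Q →
        ∃ m₀ : ℕ, 0 < m₀ ∧ ∀ m : ℕ, m₀ < m →
          ¬ BijSubst.HasProgression v a ((Q : ℤ) ^ m + n) (Q ^ m + k) ∧
          ¬ BijSubst.HasProgression v a ((Q : ℤ) ^ m - n) (Q ^ m + k))) ∧
    (Nat.card A = 2 →
      ∃ n m₀ : ℕ, 0 < n ∧ 0 < m₀ ∧ ∀ s m : ℕ, m₀ ≤ m → ∀ a : A,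
        ¬ BijSubst.HasProgression v a ((Q : ℤ) ^ (m + s) + (Q : ℤ) ^ s * n) (Q ^ m + k) ∧
        ¬ BijSubst.HasProgression v a ((Q : ℤ) ^ (m + s) - (Q : ℤ) ^ s * n) (Q ^ m + k)) := by
  open BijSubst in
  refine ⟨fun μ hμ => ?_, fun h2 =>
    not_hasProgression_of_card_eq_two hQ hprim hbij hlegal hp hfix hrep h2⟩
  simp only [measure_progSet_pos_iff hrep hμ]
  refine ⟨exists_hasProgression v (k + 1), ?_, ?_, ?_⟩
  · rintro n a s n' h - rfl
    obtain ⟨i, -, hv⟩ := eq_iterate_iterate hp hfix s 0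
    rw [hv] at h
    push_cast at h
    obtain ⟨b, hb⟩ := h.desubstitute hbij
    exact ⟨b, hb.of_iterate hQ hprim hp hfix hrep⟩
  · intro n a m _ h hm b
    obtain ⟨r, hr, rfl⟩ := mem_superword.1 (hm a b)
    apply HasProgression.of_iterate (j := m) hQ hprim hp hfix hrep
    have := h.substitute (ϱ := ϱ) hr
    push_cast
    exact this
  · intro n a _ h hn
    obtain ⟨M, hM⟩ := h.exists_eq_col_of_le hQ hbij hp hfix hrep
    refine ⟨M + 1, by omega, fun m hm => ?_⟩
    obtain ⟨r, c, hr, hc⟩ := hM m (by omega)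
    obtain ⟨i, -, hv⟩ := eq_iterate_iterate hp hfix m 0
    have := not_hasProgression_pow_add_sub (j := i) hQ hlegal hp hfix hrep hn hr
      fun i hi x hx => (col_bijective hbij _ _).1 (hx.trans (hc i hi).symm)
    rwa [← hv] at this
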